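/- **Model.** A set $V$ of $n$ anonymous nodes, one of which is a distinguished leader $\ell$, communicates in synchronous rounds. In round $r$ the links form an undirected simple graph $G_r$ on $V$, chosen by an adversary, which is connected and in which every node has at most $\Delta$ neighbors; $\Delta$ is known to the nodes. In each round every node broadcasts one message (possibly without content) to its current neighbors, receives the messages of all its current neighbors, and then computes locally. **Counting Protocol** with parameters $\Delta$, a real constant $c>1$, and a function $\tau$. It runs iterations $k=2,3,\dots$. At the start of iteration $k$ the leader has energy $e_\ell=0$ and $IsCorrect=true$, and every other node has energy $e=1$. Iteration $k$ has three phases. * *Collection Phase* ($\tau(k)$ rounds). Each non-leader broadcasts $e/(2\Delta)$; the leader's message has no content. A non-leader with $s$ neighbors sets $e\leftarrow e\,(1-\frac{s}{2\Delta})+\sum_j e_j$, and the leader sets $e_\ell\leftarrow e_\ell+\sum_j e_j$, where the $e_j$ are the received values. * *Verification Phase* ($1+\lceil k/(1-1/k^c)\rceil$ rounds). Each non-leader broadcasts the largest energy $e_{max}$ it has heard of in this phase, initially its own energy. In each round the leader sets $IsCorrect\leftarrow false$ unless $k-1-1/k^c\le e_\ell\le k-1$ and no received value exceeds $1/k^c$.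 * *Notification Phase* ($k$ rounds). If $IsCorrect$ is true, the leader broadcasts $\langle Halt\rangle$ in each round; a non-leader broadcasts $\langle Halt\rangle$ in every round of the phase after the one in which it first received it. At the end of iteration $k$ a node that has sent or received $\langle Halt\rangle$ stops with output $k$; otherwise it goes on to iteration $k+1$. **Corollary.** Let $n>6$, $1\le\Delta\le n-1$ and $1<c\le 2^n$ (so every constant $1<c\le 128$ is allowed for all $n>6$, and every constant $c>1$ for all $n>6$ with $n\ge\log_2 c$). Let $\tau(k)=k\,\lceil(2\Delta)^k\ln k\rceil$. Then on every dynamic network of $n$ nodes as above, there is a number $r$ with $$r<\frac{(2\Delta)^{n+1}(n+1)\ln(n+1)}{\ln(2\Delta)}$$ such that after $r$ rounds all nodes have stopped with output $n$, and no node stops before the end of round $r$. -/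

import Mathlib

namespace AnonymousCounting

/-- A deterministic algorithm for anonymous synchronous broadcast networks with a leader. All
non-leader nodes start in the same state, a node broadcasts one message per round, and its new
state depends only on its old state and on the multiset of messages of its current neighbours.
`output s = some k` means that a node in state `s` has terminated with output `k`. -/
structure Algorithm where
  State : Type
  Message : Type
  leaderInit : State
  nodeInit : State
  broadcast : State → Message
  update : State → Multiset Message → State
  output : State → Option ℕ

/-- The state of every node after a number of communication rounds. The edges of the dynamic graph
`G` in force in the `(r + 1)`-st round are those of `G r`. -/
def Algorithm.run {V : Type*} [Fintype V] [DecidableEq V] (A : Algorithm) (ℓ : V)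
    (G : ℕ → SimpleGraph V) [∀ r, DecidableRel (G r).Adj] : ℕ → V → A.State
  | 0 => fun v => if v = ℓ then A.leaderInit else A.nodeInit
  | r + 1 => fun v =>
      A.update (A.run ℓ G r v)
        (((G r).neighborFinset v).val.map fun u => A.broadcast (A.run ℓ G r u))

/-- Messages of the counting protocol. `blank` is a message without content: it carries no energy,
but it is counted by its receivers, who thus learn their number of neighbours. -/
inductive Message where
  | blank
  | energy (x : ℝ)
  | halt

/-- The number carried by a message, if any. -/
def Message.energy? : Message → Option ℝ
  | .energy x => some x
  | _ => none

/-- The numbers `e₁, …, eₛ` carried by the received messages. -/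
def energies (msgs : Multiset Message) : Multiset ℝ :=
  msgs.filterMap Message.energy?

/-- Variables of the leader; `clock` is the number of rounds already performed in the current
iteration, the one with size estimate `k`. -/
structure LeaderVars where
  k : ℕ
  clock : ℕ
  e : ℝ
  isCorrect : Prop
  halt : Prop

/-- Variables of a non-leader node. -/
structure NodeVars where
  k : ℕ
  clock : ℕ
  e : ℝ
  emax : ℝ
  halt : Prop

/-- A node is running as leader, running as non-leader, or has stopped with an output. -/
inductive State where
  | leader (s : LeaderVars)
  | node (s : NodeVars)
  | stopped (k : ℕ)

/-- The leader at the beginning of the iteration with estimate `k`. -/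
def LeaderVars.start (k : ℕ) : LeaderVars :=
  { k := k, clock := 0, e := 0, isCorrect := True, halt := False }

/-- A non-leader node at the beginning of the iteration with estimate `k`. -/
def NodeVars.start (k : ℕ) : NodeVars :=
  { k := k, clock := 0, e := 1, emax := 1, halt := False }

/-- The energy threshold `1 / k ^ c`. -/
noncomputable def threshold (c : ℝ) (k : ℕ) : ℝ := 1 / (k : ℝ) ^ c

/-- Number of rounds of the Verification Phase. -/
noncomputable def verificationRounds (c : ℝ) (k : ℕ) : ℕ :=
  1 + ⌈(k : ℝ) / (1 - threshold c k)⌉₊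

/-- Number of rounds of the iteration with estimate `k`: a Collection Phase of `τ k` rounds, then
the Verification Phase, then a Notification Phase of `k` rounds. -/
noncomputable def iterationRounds (c : ℝ) (τ : ℕ → ℕ) (k : ℕ) : ℕ :=
  τ k + verificationRounds c k + k

/-- Message broadcast by the leader: only in the Notification Phase has it a content. -/
noncomputable def LeaderVars.message (c : ℝ) (τ : ℕ → ℕ) (s : LeaderVars) : Message :=
  open Classical in
  if s.clock < τ s.k + verificationRounds c s.k then .blank
  else if s.isCorrect then .halt else .blank

/-- Message broadcast by a non-leader node. -/
noncomputable def NodeVars.message (Δ : ℕ) (c : ℝ) (τ : ℕ → ℕ) (s : NodeVars) : Message :=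
  open Classical in
  if s.clock < τ s.k then .energy (s.e / (2 * Δ))
  else if s.clock < τ s.k + verificationRounds c s.k then .energy s.emax
  else if s.halt then .halt else .blank

/-- Local computation of the leader at the end of a round (the clock is treated separately). -/
noncomputable def LeaderVars.compute (c : ℝ) (τ : ℕ → ℕ) (s : LeaderVars)
    (msgs : Multiset Message) : LeaderVars :=
  if s.clock < τ s.k then
    { s with e := s.e + (energies msgs).sum }
  else if s.clock < τ s.k + verificationRounds c s.k then
    { s with isCorrect := s.isCorrect ∧
        ((s.k : ℝ) - 1 - threshold c s.k ≤ s.e ∧ s.e ≤ (s.k : ℝ) - 1) ∧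
        ∀ x ∈ energies msgs, x ≤ threshold c s.k }
  else
    { s with halt := s.halt ∨ s.isCorrect }

/-- Local computation of a non-leader node at the end of a round (the clock is treated separately).
In the Collection Phase the node has given `e / (2 * Δ)` to each of its `card msgs` neighbours.
There `emax` just follows `e`, so that `emax = e` when the Verification Phase begins. -/
noncomputable def NodeVars.compute (Δ : ℕ) (c : ℝ) (τ : ℕ → ℕ) (s : NodeVars)
    (msgs : Multiset Message) : NodeVars :=
  if s.clock < τ s.k then
    let e' := s.e * (1 - (Multiset.card msgs : ℝ) / (2 * Δ)) + (energies msgs).sum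
    { s with e := e', emax := e' }
  else if s.clock < τ s.k + verificationRounds c s.k then
    { s with emax := (energies msgs).fold max s.emax }
  else
    { s with halt := s.halt ∨ Message.halt ∈ msgs }

/-- Transition of the leader: one more round of the current iteration, or, after its last round,
either stop with output `k` or start the iteration with estimate `k + 1`. -/
noncomputable def LeaderVars.next (c : ℝ) (τ : ℕ → ℕ) (s : LeaderVars)
    (msgs : Multiset Message) : State :=
  open Classical in
  if s.clock + 1 < iterationRounds c τ s.k then
    .leader { s.compute c τ msgs with clock := s.clock + 1 }
  else if (s.compute c τ msgs).halt then .stopped s.k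
  else .leader (LeaderVars.start (s.k + 1))

/-- Transition of a non-leader node. -/
noncomputable def NodeVars.next (Δ : ℕ) (c : ℝ) (τ : ℕ → ℕ) (s : NodeVars)
    (msgs : Multiset Message) : State :=
  open Classical in
  if s.clock + 1 < iterationRounds c τ s.k then
    .node { s.compute Δ c τ msgs with clock := s.clock + 1 }
  else if (s.compute Δ c τ msgs).halt then .stopped s.k
  else .node (NodeVars.start (s.k + 1))

/-- The Counting Protocol with degree bound `Δ`, threshold exponent `c` and Collection Phases of
`τ k` rounds. The first size estimate is `2`. -/
noncomputable abbrev countingProtocol (Δ : ℕ) (c : ℝ) (τ : ℕ → ℕ) : Algorithm where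
  State := State
  Message := Message
  leaderInit := .leader (LeaderVars.start 2)
  nodeInit := .node (NodeVars.start 2)
  broadcast
    | .leader s => s.message c τ
    | .node s => s.message Δ c τ
    | .stopped _ => .blank
  update
    | .leader s, msgs => s.next c τ msgs
    | .node s, msgs => s.next Δ c τ msgs
    | .stopped k, _ => .stopped k
  output
    | .stopped k => some k
    | _ => none

/-- Length of the Collection Phase: `⌈(2Δ) ^ k * ln k⌉` blocks of `k` rounds. -/
noncomputable def collectionRounds (Δ : ℕ) (k : ℕ) : ℕ :=
  k * ⌈(2 * (Δ : ℝ)) ^ k * Real.log k⌉₊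

end AnonymousCounting

/-! The leader rejects every estimate k < n and accepts k = n, so all nodes stop together when
iteration n ends.

Rejection (`not_verified_of_lt_card`): acceptance is traced backwards through the Verification
Phase. The set of nodes known to have energy at most t = 1/k^c gains a node per round backwards, so
at its start it has at least min(n, 2 + ⌈k/(1-t)⌉) members, the leader included. Energy is
conserved, so each non-leader member accounts for at least 1-t of the leader's energy, which then
exceeds k-1.

Acceptance (`verified_of_card_eq`): a Collection round is a lazy diffusion step with absorption at
the leader. A Poincaré inequality shrinks the sum of squared energies by the factor 1 - 1/(4Δ(n-1)²)
in each round, and the phase is long enough to bring the total energy below n^(-c). Then ⟨Halt⟩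
floods the network within n rounds.

The running time is a geometric sum (`startRound_lt`). -/

namespace AnonymousCounting

/-! ### Diffusion with absorption on connected graphs -/

section Graph

variable {V : Type*} [Fintype V] [DecidableEq V]

omit [DecidableEq V] in
lemma sum_neighborFinset_comm (H : SimpleGraph V) [DecidableRel H.Adj] (f : V → V → ℝ) :
    ∑ v, ∑ u ∈ H.neighborFinset v, f v u = ∑ v, ∑ u ∈ H.neighborFinset v, f u v := by
  refine Finset.sum_comm' fun v u => ?_
  simp [H.adj_comm]

omit [Fintype V] [DecidableEq V] in
-- Cauchy–Schwarz for the telescoping sum of increments along the walk.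
lemma sq_sub_le_length_mul {H : SimpleGraph V} (x : V → ℝ) {u v : V} (p : H.Walk u v) :
    (x v - x u) ^ 2 ≤
      p.length * (p.darts.map fun d => (x d.snd - x d.fst) ^ 2).sum := by
  induction p with
  | nil => simp
  | @cons u w v h p ih =>
    have hS : 0 ≤ (p.darts.map fun d => (x d.snd - x d.fst) ^ 2).sum :=
      List.sum_nonneg (by simp; intros; positivity)
    simp only [SimpleGraph.Walk.darts_cons, List.map_cons, List.sum_cons,
      SimpleGraph.Walk.length_cons]
    generalize (p.darts.map fun d => (x d.snd - x d.fst) ^ 2).sum = S at *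
    have hm : (0 : ℝ) ≤ p.length := Nat.cast_nonneg _
    push_cast
    generalize (p.length : ℝ) = m at *
    -- With a, b the two increments, b² ≤ mS, so (2ab)² ≤ 4(ma²)S ≤ (ma² + S)².
    have key : 2 * ((x w - x u) * (x v - x w)) ≤ m * (x w - x u) ^ 2 + S := by
      refine abs_le_of_sq_le_sq' ?_ (by positivity) |>.2
      nlinarith [sq_nonneg (m * (x w - x u) ^ 2 - S),
        mul_le_mul_of_nonneg_left ih (sq_nonneg (x w - x u))]
    nlinarith

/-- Twice the Dirichlet energy of `x` on the graph `H`. -/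
def dirichlet (H : SimpleGraph V) [DecidableRel H.Adj] (x : V → ℝ) : ℝ :=
  ∑ v, ∑ u ∈ H.neighborFinset v, (x u - x v) ^ 2

/-- A path repeats no edge, so its darts are distinct ordered pairs occurring in the double sum. -/
lemma sum_darts_le_dirichlet (H : SimpleGraph V) [DecidableRel H.Adj] (x : V → ℝ) {u v : V}
    {p : H.Walk u v} (hp : p.IsPath) :
    (p.darts.map fun d => (x d.snd - x d.fst) ^ 2).sum ≤ dirichlet H x := by
  have hnd : p.darts.Nodup := List.Nodup.of_map _ hp.isTrail.edges_nodup
  rw [← List.sum_toFinset _ hnd, dirichlet, Finset.sum_sigma']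
  have hinj : Set.InjOn (fun d : H.Dart => (⟨d.fst, d.snd⟩ : Σ _ : V, V)) p.darts.toFinset := by
    intro a _ b _ hab
    simp only [Sigma.mk.injEq, heq_eq_eq] at hab
    exact SimpleGraph.Dart.ext _ _ (Prod.ext hab.1 hab.2)
  rw [← Finset.sum_image (f := fun q : Σ _ : V, V => (x q.2 - x q.1) ^ 2) hinj]
  refine Finset.sum_le_sum_of_subset_of_nonneg ?_ fun _ _ _ => sq_nonneg _
  intro q hq
  simp only [Finset.mem_image] at hq
  obtain ⟨d, -, rfl⟩ := hq
  simp [d.adj]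

omit [DecidableEq V] in
lemma dirichlet_nonneg (H : SimpleGraph V) [DecidableRel H.Adj] (x : V → ℝ) :
    0 ≤ dirichlet H x :=
  Finset.sum_nonneg fun _ _ => Finset.sum_nonneg fun _ _ => sq_nonneg _

/-- A Poincaré inequality for functions vanishing at one vertex. -/
lemma sum_sq_le_dirichlet (H : SimpleGraph V) [DecidableRel H.Adj] (hH : H.Connected)
    {ℓ : V} {x : V → ℝ} (hx : x ℓ = 0) :
    ∑ v, x v ^ 2 ≤ ((Fintype.card V : ℝ) - 1) ^ 2 * dirichlet H x := by
  have hD := dirichlet_nonneg H x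
  -- A path from ℓ to v has at most n-1 edges. Summing over the n-1 vertices other than ℓ gives the
  -- second factor n-1.
  have hv : ∀ v, x v ^ 2 ≤ ((Fintype.card V : ℝ) - 1) * dirichlet H x := by
    intro v
    obtain ⟨p, hp⟩ := (hH.preconnected ℓ v).exists_isPath
    have h1 := sq_sub_le_length_mul x p
    rw [hx, sub_zero] at h1
    have h2 : (p.length : ℝ) ≤ (Fintype.card V : ℝ) - 1 := by
      have : p.length + 1 ≤ Fintype.card V := hp.length_lt
      have : ((p.length + 1 : ℕ) : ℝ) ≤ Fintype.card V := by exact_mod_cast this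
      push_cast at this; linarith
    exact h1.trans ((mul_le_mul_of_nonneg_left (sum_darts_le_dirichlet H x hp)
      (Nat.cast_nonneg _)).trans (mul_le_mul_of_nonneg_right h2 hD))
  rw [← Finset.add_sum_erase _ _ (Finset.mem_univ ℓ), hx]
  have h3 := Finset.sum_le_card_nsmul (Finset.univ.erase ℓ) (fun v => x v ^ 2) _
    (fun v _ => hv v)
  rw [nsmul_eq_mul, Finset.card_erase_of_mem (Finset.mem_univ ℓ), Finset.card_univ,
    Nat.cast_pred (Fintype.card_pos_iff.2 ⟨ℓ⟩)] at h3
  linarith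

/-- One round of energy exchange, with share `1 / (2 * Δ)` for each neighbour. -/
noncomputable def diffuse (H : SimpleGraph V) [DecidableRel H.Adj] (Δ : ℕ) (x : V → ℝ) (v : V) :
    ℝ :=
  x v * (1 - (H.degree v : ℝ) / (2 * Δ)) + ∑ u ∈ H.neighborFinset v, x u / (2 * Δ)

omit [DecidableEq V] in
lemma diffuse_eq (H : SimpleGraph V) [DecidableRel H.Adj] (Δ : ℕ) (x : V → ℝ) (v : V) :
    diffuse H Δ x v = x v + (∑ u ∈ H.neighborFinset v, (x u - x v)) / (2 * Δ) := by
  rw [diffuse, Finset.sum_sub_distrib, Finset.sum_const, H.card_neighborFinset_eq_degree,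
    ← Finset.sum_div, nsmul_eq_mul]
  ring

omit [DecidableEq V] in
lemma sum_diffuse (H : SimpleGraph V) [DecidableRel H.Adj] (Δ : ℕ) (x : V → ℝ) :
    ∑ v, diffuse H Δ x v = ∑ v, x v := by
  simp_rw [diffuse_eq, Finset.sum_add_distrib, ← Finset.sum_div]
  have h := sum_neighborFinset_comm H fun v u => x u - x v
  have h' : ∑ v, ∑ u ∈ H.neighborFinset v, (x v - x u)
      = - ∑ v, ∑ u ∈ H.neighborFinset v, (x u - x v) := by
    simp_rw [← Finset.sum_neg_distrib, neg_sub]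
  rw [h'] at h
  rw [show ∑ v, ∑ u ∈ H.neighborFinset v, (x u - x v) = 0 by linarith]
  simp

omit [DecidableEq V] in
lemma diffuse_nonneg (H : SimpleGraph V) [DecidableRel H.Adj] {Δ : ℕ} (hΔ : 1 ≤ Δ)
    (hdeg : ∀ v, H.degree v ≤ Δ) {x : V → ℝ} (hx : ∀ v, 0 ≤ x v) (v : V) :
    0 ≤ diffuse H Δ x v := by
  have hΔ' : (1 : ℝ) ≤ Δ := by exact_mod_cast hΔ
  have hd : (H.degree v : ℝ) ≤ Δ := by exact_mod_cast hdeg v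
  have : (H.degree v : ℝ) / (2 * Δ) ≤ 1 := by
    rw [div_le_one (by positivity)]; linarith
  exact add_nonneg (mul_nonneg (hx v) (by linarith))
    (Finset.sum_nonneg fun u _ => div_nonneg (hx u) (by positivity))

omit [DecidableEq V] in
lemma diffuse_le_one (H : SimpleGraph V) [DecidableRel H.Adj] {Δ : ℕ} (hΔ : 1 ≤ Δ)
    (hdeg : ∀ v, H.degree v ≤ Δ) {x : V → ℝ} (hx : ∀ v, x v ≤ 1) (v : V) :
    diffuse H Δ x v ≤ 1 := by
  have hΔ' : (1 : ℝ) ≤ Δ := by exact_mod_cast hΔ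
  have hd : (H.degree v : ℝ) ≤ Δ := by exact_mod_cast hdeg v
  have h1 : (H.degree v : ℝ) / (2 * Δ) ≤ 1 := by
    rw [div_le_one (by positivity)]; linarith
  have h2 : ∑ u ∈ H.neighborFinset v, x u / (2 * Δ) ≤ (H.degree v : ℝ) / (2 * Δ) := by
    rw [← Finset.sum_div]
    gcongr
    have := Finset.sum_le_card_nsmul (H.neighborFinset v) x 1 fun u _ => hx u
    simpa using this
  have h3 := mul_le_mul_of_nonneg_right (hx v) (sub_nonneg.2 h1)
  rw [diffuse]
  linarith

omit [DecidableEq V] in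
-- Expanding the squares, the cross terms symmetrise to -D/(2Δ), where D is `dirichlet H x`. By
-- Cauchy–Schwarz over at most Δ neighbours the quadratic terms return at most D/(4Δ). Dividing by
-- 2Δ rather than Δ is what leaves a net loss.
lemma sum_sq_diffuse_le (H : SimpleGraph V) [DecidableRel H.Adj] {Δ : ℕ} (hΔ : 1 ≤ Δ)
    (hdeg : ∀ v, H.degree v ≤ Δ) (x : V → ℝ) :
    ∑ v, diffuse H Δ x v ^ 2 ≤ ∑ v, x v ^ 2 - dirichlet H x / (4 * Δ) := by
  have hΔ' : (1 : ℝ) ≤ Δ := by exact_mod_cast hΔ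
  have h1 : ∀ v, diffuse H Δ x v ^ 2 ≤ x v ^ 2
      + (∑ u ∈ H.neighborFinset v, 2 * x v * (x u - x v)) / (2 * Δ)
      + (∑ u ∈ H.neighborFinset v, (x u - x v) ^ 2) / (4 * Δ) := by
    intro v
    have hcs := sq_sum_le_card_mul_sum_sq (s := H.neighborFinset v) (f := fun u => x u - x v)
    have hd : (H.degree v : ℝ) ≤ Δ := by exact_mod_cast hdeg v
    rw [H.card_neighborFinset_eq_degree] at hcs
    have hnn : 0 ≤ ∑ u ∈ H.neighborFinset v, (x u - x v) ^ 2 :=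
      Finset.sum_nonneg fun _ _ => sq_nonneg _
    rw [diffuse_eq, ← Finset.mul_sum]
    generalize ∑ u ∈ H.neighborFinset v, (x u - x v) ^ 2 = Q at *
    generalize ∑ u ∈ H.neighborFinset v, (x u - x v) = S at *
    have : (S / (2 * Δ)) ^ 2 ≤ Q / (4 * Δ) := by
      rw [div_pow, div_le_div_iff₀ (by positivity) (by positivity)]
      have : S ^ 2 ≤ Δ * Q := hcs.trans (mul_le_mul_of_nonneg_right hd hnn)
      nlinarith
    calc (x v + S / (2 * Δ)) ^ 2
        = x v ^ 2 + 2 * x v * S / (2 * Δ) + (S / (2 * Δ)) ^ 2 := by ring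
      _ ≤ _ := by linarith
  have h2 := Finset.sum_le_sum fun v (_ : v ∈ Finset.univ) => h1 v
  rw [Finset.sum_add_distrib, Finset.sum_add_distrib, ← Finset.sum_div, ← Finset.sum_div] at h2
  have h3 : ∑ v, ∑ u ∈ H.neighborFinset v, 2 * x v * (x u - x v) = - dirichlet H x := by
    have h := sum_neighborFinset_comm H fun v u => x v * (x u - x v)
    have h4 : dirichlet H x = - ∑ v, ∑ u ∈ H.neighborFinset v, x v * (x u - x v)
        - ∑ v, ∑ u ∈ H.neighborFinset v, x u * (x v - x u) := by
      simp_rw [dirichlet, ← Finset.sum_neg_distrib, ← Finset.sum_sub_distrib]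
      refine Finset.sum_congr rfl fun v _ => Finset.sum_congr rfl fun u _ => by ring
    rw [h4, ← h]
    simp_rw [mul_assoc, ← Finset.mul_sum]
    ring
  rw [h3] at h2
  refine h2.trans (le_of_eq ?_)
  rw [dirichlet]
  field_simp
  ring

/-- One round of energy exchange in which the leader, whose energy is not recorded,
absorbs all that it gets. -/
noncomputable def absorb (H : SimpleGraph V) [DecidableRel H.Adj] (Δ : ℕ) (ℓ : V) (x : V → ℝ)
    (v : V) : ℝ :=
  if v = ℓ then 0 else diffuse H Δ x v

/-- Resetting the leader to zero only lowers the sum of squares, and it keeps the Poincaré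
inequality applicable in the next round. -/
lemma sum_sq_absorb_le (H : SimpleGraph V) [DecidableRel H.Adj] (hH : H.Connected) {Δ : ℕ}
    (hΔ : 1 ≤ Δ) (hdeg : ∀ v, H.degree v ≤ Δ) (hcard : 1 < Fintype.card V) {ℓ : V} {x : V → ℝ}
    (hx : x ℓ = 0) :
    ∑ v, absorb H Δ ℓ x v ^ 2 ≤
      (1 - 1 / (4 * Δ * ((Fintype.card V : ℝ) - 1) ^ 2)) * ∑ v, x v ^ 2 := by
  have h1 : ∑ v, absorb H Δ ℓ x v ^ 2 ≤ ∑ v, diffuse H Δ x v ^ 2 := by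
    refine Finset.sum_le_sum fun v _ => ?_
    unfold absorb
    split_ifs
    · rw [zero_pow two_ne_zero]; positivity
    · exact le_rfl
  have h2 := sum_sq_diffuse_le H hΔ hdeg x
  have h3 := sum_sq_le_dirichlet H hH hx
  have hΔ' : (1 : ℝ) ≤ Δ := by exact_mod_cast hΔ
  have hc : (1 : ℝ) < Fintype.card V := by exact_mod_cast hcard
  have hc' : 0 < ((Fintype.card V : ℝ) - 1) ^ 2 := by nlinarith
  have h4 : (∑ v, x v ^ 2) / (4 * Δ * ((Fintype.card V : ℝ) - 1) ^ 2)
      ≤ dirichlet H x / (4 * Δ) := by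
    rw [div_le_div_iff₀ (by positivity) (by positivity)]
    nlinarith
  calc _ ≤ _ := h1
    _ ≤ _ := h2
    _ ≤ ∑ v, x v ^ 2 - (∑ v, x v ^ 2) / (4 * Δ * ((Fintype.card V : ℝ) - 1) ^ 2) := by linarith
    _ = _ := by ring

/-- In a connected graph a proper nonempty vertex set has a vertex adjacent to its outside. -/
lemma exists_adj_notMem (H : SimpleGraph V) (hH : H.Connected) {S : Finset V} {a : V}
    (ha : a ∈ S) (hS : S ≠ Finset.univ) : ∃ u ∈ S, ∃ v ∉ S, H.Adj u v := by
  obtain ⟨b, hb⟩ : ∃ b, b ∉ S := by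
    by_contra! h
    exact hS (Finset.eq_univ_iff_forall.2 h)
  obtain ⟨p⟩ := hH.preconnected a b
  obtain ⟨d, -, h1, h2⟩ := p.exists_boundary_dart (S : Set V) (by simpa) (by simpa)
  exact ⟨d.fst, by simpa using h1, d.snd, by simpa using h2, d.adj⟩

/-- A set that contains a neighbourhood of a nonempty set `S` is larger than `S`. -/
lemma card_add_one_le_of_neighbors (H : SimpleGraph V) (hH : H.Connected) {S T : Finset V}
    {a : V} (ha : a ∈ S) (hST : S ⊆ T) (hN : ∀ u ∈ S, ∀ v, H.Adj u v → v ∈ T) :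
    min (Fintype.card V) (S.card + 1) ≤ T.card := by
  by_cases hS : S = Finset.univ
  · subst hS
    exact (min_le_left _ _).trans (Finset.card_le_card hST)
  · obtain ⟨u, hu, v, hv, huv⟩ := exists_adj_notMem H hH ha hS
    refine (min_le_right _ _).trans ?_
    rw [← Finset.card_insert_of_notMem hv]
    exact Finset.card_le_card (Finset.insert_subset (hN u hu v huv) hST)

end Graph

/-! ### Sums and maxima of received values -/

section Messages

lemma energies_map_sum {ι : Type*} (s : Multiset ι) (m : ι → Message) :
    (energies (s.map m)).sum = (s.map fun u => (m u).energy?.getD 0).sum := by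
  unfold energies
  induction s using Multiset.induction_on with
  | empty => simp
  | cons a s ih =>
    rw [Multiset.map_cons, Multiset.map_cons, Multiset.sum_cons, ← ih]
    cases h : (m a).energy? with
    | none => rw [Multiset.filterMap_cons_none _ _ h]; simp
    | some x => rw [Multiset.filterMap_cons_some _ _ _ h]; simp

lemma mem_energies_map {ι : Type*} (s : Multiset ι) (m : ι → Message) (x : ℝ) :
    x ∈ energies (s.map m) ↔ ∃ u ∈ s, (m u).energy? = some x := by
  simp [energies, Multiset.mem_filterMap]

lemma fold_max_le_iff (s : Multiset ℝ) (a t : ℝ) :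
    s.fold max a ≤ t ↔ a ≤ t ∧ ∀ x ∈ s, x ≤ t := by
  induction s using Multiset.induction_on with
  | empty => simp
  | cons b s ih =>
    rw [Multiset.fold_cons_left, max_le_iff, ih, Multiset.forall_mem_cons]
    tauto

end Messages

/-! ### One iteration in isolation, then its place in the whole run -/

section Iteration

variable {V : Type*} [Fintype V] [DecidableEq V]

/-- The variables of all nodes during one iteration; the entry of the leader in the second
component is irrelevant. -/
abbrev Vars (V : Type*) := LeaderVars × (V → NodeVars)

noncomputable def Vars.message (Δ : ℕ) (c : ℝ) (τ : ℕ → ℕ) (ℓ : V) (s : Vars V) (u : V) : Message :=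
  if u = ℓ then s.1.message c τ else (s.2 u).message Δ c τ

noncomputable def Vars.inbox (Δ : ℕ) (c : ℝ) (τ : ℕ → ℕ) (ℓ : V) (H : SimpleGraph V)
    [DecidableRel H.Adj] (s : Vars V) (v : V) : Multiset Message :=
  (H.neighborFinset v).val.map (s.message Δ c τ ℓ)

def Vars.state (ℓ : V) (s : Vars V) (v : V) : State :=
  if v = ℓ then .leader s.1 else .node (s.2 v)

def Vars.start (V : Type*) (k : ℕ) : Vars V := (LeaderVars.start k, fun _ => NodeVars.start k)

/-- The variables after `j` rounds of the iteration with estimate `k` on the graphs `H`. -/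
noncomputable def iter (Δ : ℕ) (c : ℝ) (τ : ℕ → ℕ) (ℓ : V) (H : ℕ → SimpleGraph V)
    [∀ r, DecidableRel (H r).Adj] (k : ℕ) : ℕ → Vars V
  | 0 => Vars.start V k
  | j + 1 =>
    let s := iter Δ c τ ℓ H k j
    ({ s.1.compute c τ (s.inbox Δ c τ ℓ (H j) ℓ) with clock := s.1.clock + 1 },
      fun v => { (s.2 v).compute Δ c τ (s.inbox Δ c τ ℓ (H j) v) with
        clock := (s.2 v).clock + 1 })

variable (Δ : ℕ) (c : ℝ) (τ : ℕ → ℕ) (ℓ : V)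

lemma LeaderVars.compute_k (s : LeaderVars) (m : Multiset Message) :
    (s.compute c τ m).k = s.k := by
  unfold LeaderVars.compute; split_ifs <;> rfl

lemma NodeVars.compute_k (s : NodeVars) (m : Multiset Message) :
    (s.compute Δ c τ m).k = s.k := by
  unfold NodeVars.compute; split_ifs <;> rfl

omit [Fintype V] in
lemma Vars.broadcast_state (s : Vars V) (u : V) :
    (countingProtocol Δ c τ).broadcast (s.state ℓ u) = s.message Δ c τ ℓ u := by
  unfold Vars.state Vars.message
  split_ifs <;> rfl

section Fixed

variable (H : ℕ → SimpleGraph V) [∀ r, DecidableRel (H r).Adj] (k : ℕ)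

lemma iter_leader_k (j : ℕ) : (iter Δ c τ ℓ H k j).1.k = k := by
  induction j with
  | zero => rfl
  | succ j ih => simp [iter, LeaderVars.compute_k, ih]

lemma iter_leader_clock (j : ℕ) : (iter Δ c τ ℓ H k j).1.clock = j := by
  induction j with
  | zero => rfl
  | succ j ih => simp [iter, ih]

lemma iter_node_k (j : ℕ) (v : V) : ((iter Δ c τ ℓ H k j).2 v).k = k := by
  induction j with
  | zero => rfl
  | succ j ih => simp [iter, NodeVars.compute_k, ih]

lemma iter_node_clock (j : ℕ) (v : V) : ((iter Δ c τ ℓ H k j).2 v).clock = j := by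
  induction j with
  | zero => rfl
  | succ j ih => simp [iter, ih]

/-- Energies of the non-leader nodes; the leader counts as zero. -/
noncomputable def energyAt (j : ℕ) (v : V) : ℝ :=
  if v = ℓ then 0 else ((iter Δ c τ ℓ H k j).2 v).e

/-! ### Collection Phase -/

section Collection

variable {j : ℕ} (hj : j < τ k)
include hj

lemma energy?_message_collection (u : V) :
    ((iter Δ c τ ℓ H k j).message Δ c τ ℓ u).energy?.getD 0
      = energyAt Δ c τ ℓ H k j u / (2 * Δ) := by
  unfold Vars.message energyAt
  split_ifs with h
  · simp [LeaderVars.message, iter_leader_clock, iter_leader_k, Message.energy?,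
      show j < τ k + verificationRounds c k by omega]
  · simp [NodeVars.message, iter_node_clock, iter_node_k, hj, Message.energy?]

lemma sum_energies_collection (v : V) :
    (energies ((iter Δ c τ ℓ H k j).inbox Δ c τ ℓ (H j) v)).sum
      = ∑ u ∈ (H j).neighborFinset v, energyAt Δ c τ ℓ H k j u / (2 * Δ) := by
  rw [Vars.inbox, energies_map_sum]
  simp_rw [energy?_message_collection Δ c τ ℓ H k hj]
  rfl

lemma energyAt_succ : energyAt Δ c τ ℓ H k (j + 1)
    = absorb (H j) Δ ℓ (energyAt Δ c τ ℓ H k j) := by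
  funext v
  rw [absorb]
  by_cases h : v = ℓ
  · simp [h, energyAt]
  · rw [if_neg h, diffuse, ← sum_energies_collection Δ c τ ℓ H k hj v]
    simp [energyAt, h, iter, NodeVars.compute, iter_node_clock, iter_node_k, hj, Vars.inbox]

lemma leader_e_succ : (iter Δ c τ ℓ H k (j + 1)).1.e = (iter Δ c τ ℓ H k j).1.e
    + ∑ u ∈ (H j).neighborFinset ℓ, energyAt Δ c τ ℓ H k j u / (2 * Δ) := by
  rw [← sum_energies_collection Δ c τ ℓ H k hj]
  simp [iter, LeaderVars.compute, iter_leader_clock, iter_leader_k, hj]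

end Collection

lemma energyAt_leader (j : ℕ) : energyAt Δ c τ ℓ H k j ℓ = 0 := by simp [energyAt]

lemma energyAt_zero (v : V) : energyAt Δ c τ ℓ H k 0 v = if v = ℓ then 0 else 1 := rfl

lemma leader_e_add_sum_energyAt {j : ℕ} (hj : j ≤ τ k) :
    (iter Δ c τ ℓ H k j).1.e + ∑ v, energyAt Δ c τ ℓ H k j v = (Fintype.card V : ℝ) - 1 := by
  induction j with
  | zero =>
    simp_rw [energyAt_zero]
    rw [← Finset.add_sum_erase _ _ (Finset.mem_univ ℓ),
      Finset.sum_congr rfl fun v hv => if_neg (Finset.ne_of_mem_erase hv)]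
    simp [iter, Vars.start, LeaderVars.start, Finset.card_erase_of_mem,
      Nat.cast_pred (Fintype.card_pos_iff.2 ⟨ℓ⟩)]
  | succ j ih =>
    have ih := ih (by omega)
    rw [energyAt_succ Δ c τ ℓ H k hj, leader_e_succ Δ c τ ℓ H k hj]
    have h1 := sum_diffuse (H j) Δ (energyAt Δ c τ ℓ H k j)
    rw [← Finset.add_sum_erase _ _ (Finset.mem_univ ℓ)] at h1
    have h2 : ∑ v ∈ Finset.univ.erase ℓ, absorb (H j) Δ ℓ (energyAt Δ c τ ℓ H k j) v
        = ∑ v ∈ Finset.univ.erase ℓ, diffuse (H j) Δ (energyAt Δ c τ ℓ H k j) v :=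
      Finset.sum_congr rfl fun v hv => if_neg (Finset.ne_of_mem_erase hv)
    rw [← Finset.add_sum_erase _ _ (Finset.mem_univ ℓ), h2, absorb, if_pos rfl]
    -- As the leader's entry is zero, `diffuse` at ℓ is exactly what the leader receives in this
    -- round.
    rw [diffuse, energyAt_leader] at h1
    linarith

lemma energyAt_mem_Icc (hΔ : 1 ≤ Δ) (hdeg : ∀ r v, (H r).degree v ≤ Δ) {j : ℕ} (hj : j ≤ τ k) :
    ∀ v, 0 ≤ energyAt Δ c τ ℓ H k j v ∧ energyAt Δ c τ ℓ H k j v ≤ 1 := by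
  induction j with
  | zero => intro v; rw [energyAt_zero]; split_ifs <;> norm_num
  | succ j ih =>
    intro v
    have ih := ih (by omega)
    rw [energyAt_succ Δ c τ ℓ H k hj, absorb]
    split_ifs
    · norm_num
    · exact ⟨diffuse_nonneg _ hΔ (hdeg j) (fun v => (ih v).1) v,
        diffuse_le_one _ hΔ (hdeg j) (fun v => (ih v).2) v⟩

lemma sum_sq_energyAt_le (hΔ : 1 ≤ Δ) (hconn : ∀ r, (H r).Connected)
    (hdeg : ∀ r v, (H r).degree v ≤ Δ) (hcard : 1 < Fintype.card V) {j : ℕ} (hj : j ≤ τ k) :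
    ∑ v, energyAt Δ c τ ℓ H k j v ^ 2 ≤
      (1 - 1 / (4 * Δ * ((Fintype.card V : ℝ) - 1) ^ 2)) ^ j * Fintype.card V := by
  induction j with
  | zero =>
    simp_rw [energyAt_zero]
    have := Finset.sum_le_card_nsmul Finset.univ
      (fun v => (if v = ℓ then (0 : ℝ) else 1) ^ 2) 1 (fun v _ => by split_ifs <;> norm_num)
    simpa using this
  | succ j ih =>
    have ih := ih (by omega)
    rw [energyAt_succ Δ c τ ℓ H k hj]
    refine (sum_sq_absorb_le (H j) (hconn j) hΔ (hdeg j) hcard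
      (energyAt_leader Δ c τ ℓ H k j)).trans ?_
    rw [pow_succ' _ j, mul_assoc (1 - _)]
    refine mul_le_mul_of_nonneg_left ih ?_
    have hΔ' : (1 : ℝ) ≤ Δ := by exact_mod_cast hΔ
    have hc : (2 : ℝ) ≤ Fintype.card V := by exact_mod_cast hcard
    rw [sub_nonneg, div_le_one (by nlinarith [sq_nonneg ((Fintype.card V : ℝ) - 1)])]
    nlinarith

lemma iter_leader_of_le {j : ℕ} (hj : j ≤ τ k) :
    (iter Δ c τ ℓ H k j).1.isCorrect = True ∧ (iter Δ c τ ℓ H k j).1.halt = False := by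
  induction j with
  | zero => exact ⟨rfl, rfl⟩
  | succ j ih =>
    obtain ⟨h1, h2⟩ := ih (by omega)
    have hj' : j < τ k := hj
    simp [iter, LeaderVars.compute, iter_leader_clock, iter_leader_k, hj', h1, h2]

lemma iter_node_of_le {j : ℕ} (hj : j ≤ τ k) (v : V) :
    ((iter Δ c τ ℓ H k j).2 v).emax = ((iter Δ c τ ℓ H k j).2 v).e ∧
      ((iter Δ c τ ℓ H k j).2 v).halt = False := by
  induction j with
  | zero => exact ⟨rfl, rfl⟩
  | succ j ih =>
    obtain ⟨h1, h2⟩ := ih (by omega)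
    have hj' : j < τ k := hj
    simp [iter, NodeVars.compute, iter_node_clock, iter_node_k, hj', h2]

/-! ### Verification Phase -/

section Verification

variable {i : ℕ} (hi : i < verificationRounds c k)
include hi

lemma forall_energies_verification (v : V) (t : ℝ) :
    (∀ x ∈ energies ((iter Δ c τ ℓ H k (τ k + i)).inbox Δ c τ ℓ (H (τ k + i)) v), x ≤ t) ↔
      ∀ u, (H (τ k + i)).Adj v u → u ≠ ℓ → ((iter Δ c τ ℓ H k (τ k + i)).2 u).emax ≤ t := by
  have h1 : ((iter Δ c τ ℓ H k (τ k + i)).message Δ c τ ℓ ℓ).energy? = none := by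
    simp [Vars.message, LeaderVars.message, iter_leader_clock, iter_leader_k, Message.energy?, hi]
  have h2 : ∀ u, u ≠ ℓ → ((iter Δ c τ ℓ H k (τ k + i)).message Δ c τ ℓ u).energy?
      = some ((iter Δ c τ ℓ H k (τ k + i)).2 u).emax := by
    intro u hu
    simp [Vars.message, NodeVars.message, iter_node_clock, iter_node_k, Message.energy?, hi, hu]
  simp only [Vars.inbox, mem_energies_map, Finset.mem_val, SimpleGraph.mem_neighborFinset]
  constructor
  · intro h u hu hul
    exact h _ ⟨u, hu, h2 u hul⟩
  · rintro h x ⟨u, hu, hx⟩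
    have hul : u ≠ ℓ := by
      rintro rfl
      simp [h1] at hx
    rw [h2 u hul, Option.some_inj] at hx
    exact hx ▸ h u hu hul

lemma emax_succ_le_iff (v : V) (t : ℝ) :
    ((iter Δ c τ ℓ H k (τ k + i + 1)).2 v).emax ≤ t ↔
      ((iter Δ c τ ℓ H k (τ k + i)).2 v).emax ≤ t ∧
      ∀ u, (H (τ k + i)).Adj v u → u ≠ ℓ → ((iter Δ c τ ℓ H k (τ k + i)).2 u).emax ≤ t := by
  rw [← forall_energies_verification Δ c τ ℓ H k hi v t, ← fold_max_le_iff]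
  simp [iter, NodeVars.compute, iter_node_clock, iter_node_k, hi]

lemma isCorrect_succ_iff :
    (iter Δ c τ ℓ H k (τ k + i + 1)).1.isCorrect ↔
      (iter Δ c τ ℓ H k (τ k + i)).1.isCorrect ∧
      (((k : ℝ) - 1 - threshold c k ≤ (iter Δ c τ ℓ H k (τ k + i)).1.e ∧
        (iter Δ c τ ℓ H k (τ k + i)).1.e ≤ (k : ℝ) - 1) ∧
      ∀ u, (H (τ k + i)).Adj ℓ u → u ≠ ℓ →
        ((iter Δ c τ ℓ H k (τ k + i)).2 u).emax ≤ threshold c k) := by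
  rw [← forall_energies_verification Δ c τ ℓ H k hi ℓ]
  simp [iter, LeaderVars.compute, iter_leader_clock, iter_leader_k, hi]

lemma leader_verification_succ :
    (iter Δ c τ ℓ H k (τ k + i + 1)).1.e = (iter Δ c τ ℓ H k (τ k + i)).1.e ∧
      (iter Δ c τ ℓ H k (τ k + i + 1)).1.halt = (iter Δ c τ ℓ H k (τ k + i)).1.halt := by
  simp [iter, LeaderVars.compute, iter_leader_clock, iter_leader_k, hi]

lemma node_halt_verification_succ (v : V) :
    ((iter Δ c τ ℓ H k (τ k + i + 1)).2 v).halt = ((iter Δ c τ ℓ H k (τ k + i)).2 v).halt := by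
  simp [iter, NodeVars.compute, iter_node_clock, iter_node_k, hi]

end Verification

lemma leader_verification {i : ℕ} (hi : i ≤ verificationRounds c k) :
    (iter Δ c τ ℓ H k (τ k + i)).1.e = (iter Δ c τ ℓ H k (τ k)).1.e ∧
      (iter Δ c τ ℓ H k (τ k + i)).1.halt = False := by
  induction i with
  | zero => exact ⟨rfl, (iter_leader_of_le Δ c τ ℓ H k le_rfl).2⟩
  | succ i ih =>
    have h := leader_verification_succ Δ c τ ℓ H k (i := i) (by omega)
    have ih := ih (by omega)
    exact ⟨h.1.trans ih.1, h.2.trans ih.2⟩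

lemma node_halt_verification {i : ℕ} (hi : i ≤ verificationRounds c k) (v : V) :
    ((iter Δ c τ ℓ H k (τ k + i)).2 v).halt = False := by
  induction i with
  | zero => exact (iter_node_of_le Δ c τ ℓ H k le_rfl v).2
  | succ i ih =>
    exact (node_halt_verification_succ Δ c τ ℓ H k (i := i) (by omega) v).trans (ih (by omega))

/-- The outcome of the Verification Phase. -/
def Verified : Prop := (iter Δ c τ ℓ H k (τ k + verificationRounds c k)).1.isCorrect

lemma isCorrect_of_verified (h : Verified Δ c τ ℓ H k) (i : ℕ) (hi : i ≤ verificationRounds c k) :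
    (iter Δ c τ ℓ H k (τ k + i)).1.isCorrect := by
  refine Nat.decreasingInduction' (P := fun i => (iter Δ c τ ℓ H k (τ k + i)).1.isCorrect)
    ?_ hi h
  intro j hj _ hc
  exact ((isCorrect_succ_iff Δ c τ ℓ H k hj).1 hc).1

lemma emax_verification_start {v : V} (hv : v ≠ ℓ) :
    ((iter Δ c τ ℓ H k (τ k)).2 v).emax = energyAt Δ c τ ℓ H k (τ k) v := by
  rw [(iter_node_of_le Δ c τ ℓ H k le_rfl v).1, energyAt, if_neg hv]

/-- If the leader accepts, the nodes that it has heard of have little energy. -/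
lemma card_low_energy_of_verified (hconn : ∀ r, (H r).Connected) (h : Verified Δ c τ ℓ H k) :
    min (Fintype.card V) (verificationRounds c k + 1) ≤
      (Finset.univ.filter fun v => energyAt Δ c τ ℓ H k (τ k) v ≤ threshold c k).card := by
  classical
  set R := verificationRounds c k with hR
  -- The leader belongs to every `Q i` by fiat, since its `emax` is meaningless. The induction runs
  -- backwards in time from `Q R`, which is only known to contain ℓ.
  let Q : ℕ → Finset V := fun i => Finset.univ.filter fun v =>
    v = ℓ ∨ ((iter Δ c τ ℓ H k (τ k + i)).2 v).emax ≤ threshold c k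
  have hQ : ∀ i ≤ R, min (Fintype.card V) (R - i + 1) ≤ (Q i).card := by
    intro i hi
    refine Nat.decreasingInduction'
      (P := fun i => min (Fintype.card V) (R - i + 1) ≤ (Q i).card) ?_ hi ?_
    · intro i hi _ ih
      have hacc := (isCorrect_succ_iff Δ c τ ℓ H k hi).1
        (isCorrect_of_verified Δ c τ ℓ H k h (i + 1) hi)
      -- A low maximum after the round bounds everything received in it, so all neighbours were low
      -- before it. For the leader, its acceptance says the same.
      have := card_add_one_le_of_neighbors (H (τ k + i)) (hconn _) (S := Q (i + 1)) (T := Q i)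
        (a := ℓ) (by simp [Q]) ?_ ?_
      · omega
      · intro v hv
        simp only [Q, Finset.mem_filter, Finset.mem_univ, true_and] at hv ⊢
        exact hv.imp_right fun hv => ((emax_succ_le_iff Δ c τ ℓ H k hi v _).1 hv).1
      · intro u hu v huv
        simp only [Q, Finset.mem_filter, Finset.mem_univ, true_and] at hu ⊢
        by_cases hv : v = ℓ
        · exact Or.inl hv
        · rcases hu with rfl | hu
          · exact Or.inr (hacc.2.2 v huv hv)
          · exact Or.inr (((emax_succ_le_iff Δ c τ ℓ H k hi u _).1 hu).2 v huv hv)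
    · have : 0 < (Q R).card := Finset.card_pos.2 ⟨ℓ, by simp [Q]⟩
      omega
  refine (hQ 0 (Nat.zero_le _)).trans (Finset.card_le_card ?_)
  intro v hv
  simp only [Q, Finset.mem_filter, Finset.mem_univ, true_and] at hv ⊢
  by_cases hvl : v = ℓ
  · rw [hvl, energyAt_leader]
    unfold threshold
    positivity
  · rw [← emax_verification_start Δ c τ ℓ H k hvl]
    exact hv.resolve_left hvl

/-- The leader's energy is frozen during verification, so the test made in the first round suffices.
-/
lemma leader_e_le_of_verified (h : Verified Δ c τ ℓ H k) :
    (iter Δ c τ ℓ H k (τ k)).1.e ≤ (k : ℝ) - 1 := by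
  have hR : 0 < verificationRounds c k := by unfold verificationRounds; omega
  exact ((isCorrect_succ_iff Δ c τ ℓ H k hR).1
    (isCorrect_of_verified Δ c τ ℓ H k h _ (show 0 + 1 ≤ _ from hR))).2.1.2

/-- A verification succeeds if the non-leader nodes have little energy in total. -/
lemma verified_of_sum_le (hΔ : 1 ≤ Δ) (hdeg : ∀ r v, (H r).degree v ≤ Δ)
    (hk : Fintype.card V = k)
    (hsum : ∑ v, energyAt Δ c τ ℓ H k (τ k) v ≤ threshold c k) : Verified Δ c τ ℓ H k := by
  have hnn := fun v => (energyAt_mem_Icc Δ c τ ℓ H k hΔ hdeg le_rfl v).1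
  have hlow : ∀ v, energyAt Δ c τ ℓ H k (τ k) v ≤ threshold c k := fun v =>
    (Finset.single_le_sum (fun u _ => hnn u) (Finset.mem_univ v)).trans hsum
  have hcons := leader_e_add_sum_energyAt Δ c τ ℓ H k le_rfl
  rw [hk] at hcons
  have hsum0 := Finset.sum_nonneg fun v (_ : v ∈ Finset.univ) => hnn v
  have hemax : ∀ i ≤ verificationRounds c k, ∀ v, v ≠ ℓ →
      ((iter Δ c τ ℓ H k (τ k + i)).2 v).emax ≤ threshold c k := by
    intro i
    induction i with
    | zero =>
      intro _ v hv
      rw [Nat.add_zero, emax_verification_start Δ c τ ℓ H k hv]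
      exact hlow v
    | succ i ih =>
      intro hi v hv
      have ih := ih (by omega)
      exact (emax_succ_le_iff Δ c τ ℓ H k hi v _).2 ⟨ih v hv, fun u _ hu => ih u hu⟩
  have hc : ∀ i ≤ verificationRounds c k, (iter Δ c τ ℓ H k (τ k + i)).1.isCorrect := by
    intro i
    induction i with
    | zero =>
      intro _
      rw [Nat.add_zero, (iter_leader_of_le Δ c τ ℓ H k le_rfl).1]
      trivial
    | succ i ih =>
      intro hi
      refine (isCorrect_succ_iff Δ c τ ℓ H k hi).2 ⟨ih (by omega), ?_,
        fun u _ hu => hemax i (by omega) u hu⟩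
      rw [(leader_verification Δ c τ ℓ H k (i := i) (by omega)).1]
      constructor <;> linarith
  exact hc _ le_rfl

/-! ### Notification Phase -/

lemma isCorrect_notification (i : ℕ) :
    (iter Δ c τ ℓ H k (τ k + verificationRounds c k + i)).1.isCorrect =
      Verified Δ c τ ℓ H k := by
  induction i with
  | zero => rfl
  | succ i ih =>
    rw [← ih, ← add_assoc]
    simp [iter, LeaderVars.compute, iter_leader_clock, iter_leader_k, add_assoc]

lemma leader_halt_succ (i : ℕ) :
    (iter Δ c τ ℓ H k (τ k + verificationRounds c k + i + 1)).1.halt ↔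
      (iter Δ c τ ℓ H k (τ k + verificationRounds c k + i)).1.halt ∨ Verified Δ c τ ℓ H k := by
  rw [← isCorrect_notification Δ c τ ℓ H k i]
  simp [iter, LeaderVars.compute, iter_leader_clock, iter_leader_k, add_assoc]

lemma node_halt_succ (i : ℕ) (v : V) :
    ((iter Δ c τ ℓ H k (τ k + verificationRounds c k + i + 1)).2 v).halt ↔
      ((iter Δ c τ ℓ H k (τ k + verificationRounds c k + i)).2 v).halt ∨
      ∃ u, (H (τ k + verificationRounds c k + i)).Adj v u ∧
        ((u = ℓ ∧ Verified Δ c τ ℓ H k) ∨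
        (u ≠ ℓ ∧ ((iter Δ c τ ℓ H k (τ k + verificationRounds c k + i)).2 u).halt)) := by
  set j := τ k + verificationRounds c k + i with hj
  have hm : ∀ u, (iter Δ c τ ℓ H k j).message Δ c τ ℓ u = Message.halt ↔
      ((u = ℓ ∧ Verified Δ c τ ℓ H k) ∨ (u ≠ ℓ ∧ ((iter Δ c τ ℓ H k j).2 u).halt)) := by
    intro u
    rw [← isCorrect_notification Δ c τ ℓ H k i, ← hj]
    by_cases hu : u = ℓ
    · simp [Vars.message, hu, LeaderVars.message, iter_leader_clock, iter_leader_k,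
        show ¬ j < τ k + verificationRounds c k by omega]
    · simp [Vars.message, hu, NodeVars.message, iter_node_clock, iter_node_k,
        show ¬ j < τ k + verificationRounds c k by omega, show ¬ j < τ k by omega]
  have : ((iter Δ c τ ℓ H k (j + 1)).2 v).halt ↔ ((iter Δ c τ ℓ H k j).2 v).halt ∨
      Message.halt ∈ (iter Δ c τ ℓ H k j).inbox Δ c τ ℓ (H j) v := by
    simp [iter, NodeVars.compute, iter_node_clock, iter_node_k,
      show ¬ j < τ k + verificationRounds c k by omega, show ¬ j < τ k by omega]
  rw [this]
  simp only [Vars.inbox, Multiset.mem_map, Finset.mem_val, SimpleGraph.mem_neighborFinset, hm]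

lemma not_halt_of_not_verified (h : ¬ Verified Δ c τ ℓ H k) (i : ℕ) :
    ¬ (iter Δ c τ ℓ H k (τ k + verificationRounds c k + i)).1.halt ∧
      ∀ v, ¬ ((iter Δ c τ ℓ H k (τ k + verificationRounds c k + i)).2 v).halt := by
  induction i with
  | zero =>
    refine ⟨fun hh => ?_, fun v hh => ?_⟩
    · rw [Nat.add_zero, (leader_verification Δ c τ ℓ H k le_rfl).2] at hh
      exact hh
    · rw [Nat.add_zero, node_halt_verification Δ c τ ℓ H k le_rfl v] at hh
      exact hh
  | succ i ih =>
    rw [← add_assoc, leader_halt_succ]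
    simp_rw [node_halt_succ]
    grind

/-- Flooding: in a connected graph the set of informed nodes grows every round until it is
everything, so k = n rounds are enough. -/
lemma halt_of_verified (hconn : ∀ r, (H r).Connected) (h : Verified Δ c τ ℓ H k)
    (hk : Fintype.card V = k) :
    (iter Δ c τ ℓ H k (iterationRounds c τ k)).1.halt ∧
      ∀ v, v ≠ ℓ → ((iter Δ c τ ℓ H k (iterationRounds c τ k)).2 v).halt := by
  classical
  have hpos : 0 < Fintype.card V := Fintype.card_pos_iff.2 ⟨ℓ⟩
  constructor
  · obtain ⟨m, rfl⟩ : ∃ m, k = m + 1 := ⟨k - 1, by omega⟩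
    rw [iterationRounds, ← add_assoc]
    exact (leader_halt_succ Δ c τ ℓ H _ m).2 (Or.inr h)
  · let Q : ℕ → Finset V := fun i => Finset.univ.filter fun v =>
      v = ℓ ∨ ((iter Δ c τ ℓ H k (τ k + verificationRounds c k + i)).2 v).halt
    have hQ : ∀ i, min (Fintype.card V) (i + 1) ≤ (Q i).card := by
      intro i
      induction i with
      | zero =>
        have : 0 < (Q 0).card := Finset.card_pos.2 ⟨ℓ, by simp [Q]⟩
        omega
      | succ i ih =>
        have := card_add_one_le_of_neighbors (H (τ k + verificationRounds c k + i)) (hconn _)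
          (S := Q i) (T := Q (i + 1)) (a := ℓ) (by simp [Q]) ?_ ?_
        · omega
        · intro v hv
          simp only [Q, Finset.mem_filter, Finset.mem_univ, true_and] at hv ⊢
          exact hv.imp_right fun hv => (node_halt_succ Δ c τ ℓ H k i v).2 (Or.inl hv)
        · intro u hu v huv
          simp only [Q, Finset.mem_filter, Finset.mem_univ, true_and] at hu ⊢
          refine Or.inr ((node_halt_succ Δ c τ ℓ H k i v).2 (Or.inr ⟨u, huv.symm, ?_⟩))
          by_cases hul : u = ℓ
          · exact Or.inl ⟨hul, h⟩
          · exact Or.inr ⟨hul, hu.resolve_left hul⟩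
    have huniv : Q k = Finset.univ := by
      rw [← Finset.card_eq_iff_eq_univ]
      have := hQ k
      have := (Q k).card_le_univ
      omega
    intro v hv
    have := Finset.mem_univ v
    rw [← huniv] at this
    simp only [Q, Finset.mem_filter, Finset.mem_univ, true_and] at this
    exact this.resolve_left hv

end Fixed

/-! ### From single iterations to the execution of the protocol -/

section Run

variable (G : ℕ → SimpleGraph V) [∀ r, DecidableRel (G r).Adj] (k T : ℕ)

lemma run_succ (T : ℕ) (v : V) :
    (countingProtocol Δ c τ).run ℓ G (T + 1) v =
      (countingProtocol Δ c τ).update ((countingProtocol Δ c τ).run ℓ G T v)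
        (((G T).neighborFinset v).val.map fun u =>
          (countingProtocol Δ c τ).broadcast ((countingProtocol Δ c τ).run ℓ G T u)) := rfl

lemma run_succ_of_eq_state {T : ℕ} {s : Vars V}
    (h : (countingProtocol Δ c τ).run ℓ G T = s.state ℓ) (v : V) :
    (countingProtocol Δ c τ).run ℓ G (T + 1) v =
      if v = ℓ then s.1.next c τ (s.inbox Δ c τ ℓ (G T) ℓ)
      else (s.2 v).next Δ c τ (s.inbox Δ c τ ℓ (G T) v) := by
  rw [run_succ, h, show (fun u => (countingProtocol Δ c τ).broadcast (s.state ℓ u)) =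
    s.message Δ c τ ℓ from funext (Vars.broadcast_state Δ c τ ℓ s)]
  unfold Vars.state Vars.inbox
  split_ifs with hv
  · subst hv; rfl
  · rfl

/-- Before its last round an iteration neither stops nor restarts a node, so the run follows `iter`
on the graph sequence shifted by `T`. -/
lemma run_add_eq_state
    (h : (countingProtocol Δ c τ).run ℓ G T = (Vars.start V k).state ℓ) {j : ℕ}
    (hj : j < iterationRounds c τ k) :
    (countingProtocol Δ c τ).run ℓ G (T + j) =
      (iter Δ c τ ℓ (fun r => G (T + r)) k j).state ℓ := by
  induction j with
  | zero => exact h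
  | succ j ih =>
    funext v
    rw [← add_assoc, run_succ_of_eq_state Δ c τ ℓ G (ih (by omega)), Vars.state]
    split_ifs with hv
    · rw [LeaderVars.next, if_pos (by rwa [iter_leader_k, iter_leader_clock])]
      rfl
    · rw [NodeVars.next, if_pos (by rwa [iter_node_k, iter_node_clock])]
      rfl

open Classical in
lemma run_add_iterationRounds
    (h : (countingProtocol Δ c τ).run ℓ G T = (Vars.start V k).state ℓ) (v : V) :
    (countingProtocol Δ c τ).run ℓ G (T + iterationRounds c τ k) v =
      if v = ℓ then
        if (iter Δ c τ ℓ (fun r => G (T + r)) k (iterationRounds c τ k)).1.halt then .stopped k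
        else .leader (LeaderVars.start (k + 1))
      else
        if ((iter Δ c τ ℓ (fun r => G (T + r)) k (iterationRounds c τ k)).2 v).halt
        then .stopped k
        else .node (NodeVars.start (k + 1)) := by
  obtain ⟨j, hj⟩ : ∃ j, iterationRounds c τ k = j + 1 :=
    ⟨iterationRounds c τ k - 1, by unfold iterationRounds verificationRounds; omega⟩
  rw [hj, ← add_assoc,
    run_succ_of_eq_state Δ c τ ℓ G (run_add_eq_state Δ c τ ℓ G k T h (j := j) (by omega))]
  by_cases hv : v = ℓ
  · rw [if_pos hv, if_pos hv, LeaderVars.next,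
      if_neg (by rw [iter_leader_k, iter_leader_clock]; omega), iter_leader_k]
    rfl
  · rw [if_neg hv, if_neg hv, NodeVars.next,
      if_neg (by rw [iter_node_k, iter_node_clock]; omega), iter_node_k]
    rfl

lemma run_eq_start_of_not_verified
    (h : (countingProtocol Δ c τ).run ℓ G T = (Vars.start V k).state ℓ)
    (hv : ¬ Verified Δ c τ ℓ (fun r => G (T + r)) k) :
    (countingProtocol Δ c τ).run ℓ G (T + iterationRounds c τ k) =
      (Vars.start V (k + 1)).state ℓ := by
  funext v
  have hn := not_halt_of_not_verified Δ c τ ℓ (fun r => G (T + r)) k hv k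
  rw [run_add_iterationRounds Δ c τ ℓ G k T h, iterationRounds, if_neg hn.1, if_neg (hn.2 v)]
  rfl

lemma run_eq_stopped_of_verified (hconn : ∀ r, (G r).Connected) (hk : Fintype.card V = k)
    (h : (countingProtocol Δ c τ).run ℓ G T = (Vars.start V k).state ℓ)
    (hv : Verified Δ c τ ℓ (fun r => G (T + r)) k) (v : V) :
    (countingProtocol Δ c τ).run ℓ G (T + iterationRounds c τ k) v = .stopped k := by
  have hh := halt_of_verified Δ c τ ℓ (fun r => G (T + r)) k (fun r => hconn _) hv hk
  rw [run_add_iterationRounds Δ c τ ℓ G k T h, if_pos hh.1]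
  split_ifs with h1 h2
  · rfl
  · rfl
  · exact absurd (hh.2 v h1) h2

lemma run_eq_stopped_of_le {v : V} {t : ℕ}
    (h : (countingProtocol Δ c τ).run ℓ G T v = .stopped k) (ht : T ≤ t) :
    (countingProtocol Δ c τ).run ℓ G t v = .stopped k := by
  induction t, ht using Nat.le_induction with
  | base => exact h
  | succ t _ ih => rw [run_succ, ih]

omit [Fintype V] in
lemma output_state (s : Vars V) (v : V) :
    (countingProtocol Δ c τ).output (s.state ℓ v) = none := by
  unfold Vars.state
  split_ifs <;> rfl

end Run

end Iteration

/-! ### Numerical estimates -/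

section Bounds

lemma threshold_pos (c : ℝ) {k : ℕ} (hk : 2 ≤ k) : 0 < threshold c k := by
  have : (0 : ℝ) < k := by exact_mod_cast (by omega : 0 < k)
  unfold threshold
  positivity

lemma mul_threshold_lt_one {c : ℝ} (hc : 1 < c) {k : ℕ} (hk : 2 ≤ k) :
    (k : ℝ) * threshold c k < 1 := by
  have hk' : (1 : ℝ) < k := by exact_mod_cast hk
  have h := Real.rpow_lt_rpow_of_exponent_lt hk' hc
  rw [Real.rpow_one] at h
  rw [threshold, mul_one_div, div_lt_one (by positivity)]
  exact h

lemma threshold_lt_half {c : ℝ} (hc : 1 < c) {k : ℕ} (hk : 2 ≤ k) : threshold c k < 1 / 2 := by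
  have h1 := mul_threshold_lt_one hc hk
  have h2 := threshold_pos c hk
  have hk' : (2 : ℝ) ≤ k := by exact_mod_cast hk
  nlinarith

lemma verificationRounds_le {c : ℝ} (hc : 1 < c) {k : ℕ} (hk : 2 ≤ k) :
    verificationRounds c k ≤ 1 + 2 * k := by
  have h := threshold_lt_half hc hk
  refine Nat.add_le_add_left (Nat.ceil_le.2 ?_) 1
  rw [div_le_iff₀ (by linarith)]
  push_cast
  nlinarith [(Nat.cast_nonneg k : (0 : ℝ) ≤ k)]

lemma mul_pow_mul_log_le_collectionRounds (Δ k : ℕ) :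
    (k : ℝ) * ((2 * (Δ : ℝ)) ^ k * Real.log k) ≤ collectionRounds Δ k := by
  unfold collectionRounds
  push_cast
  exact mul_le_mul_of_nonneg_left (Nat.le_ceil _) (Nat.cast_nonneg k)

lemma iterationRounds_le {c : ℝ} (hc : 1 < c) {Δ : ℕ} (hΔ : 2 ≤ Δ) {k : ℕ} (hk : 2 ≤ k) :
    (iterationRounds c (collectionRounds Δ) k : ℝ) ≤
      3 / 2 * (k * Real.log k) * (2 * (Δ : ℝ)) ^ k := by
  have hk' : (2 : ℝ) ≤ k := by exact_mod_cast hk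
  have hd : (4 : ℝ) ≤ 2 * Δ := by
    have : (2 : ℝ) ≤ Δ := by exact_mod_cast hΔ
    linarith
  have hlog : (0.69 : ℝ) ≤ Real.log k :=
    le_trans (by linarith [Real.log_two_gt_d9]) (Real.log_le_log two_pos hk')
  have hpow : (16 : ℝ) ≤ (2 * (Δ : ℝ)) ^ k := by
    calc (16 : ℝ) = 4 ^ 2 := by norm_num
      _ ≤ (2 * (Δ : ℝ)) ^ 2 := by gcongr
      _ ≤ _ := pow_le_pow_right₀ (by linarith) hk
  have hv : (verificationRounds c k : ℝ) ≤ 1 + 2 * k := by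
    exact_mod_cast verificationRounds_le hc hk
  -- The iteration takes at most k(x+1) + (1+2k) + k = kx + 4k + 1 rounds. Since x ≥ 11, the term
  -- kx/2 absorbs 4k + 1.
  have hx : 11 ≤ (2 * (Δ : ℝ)) ^ k * Real.log k := by nlinarith
  have hceil := (Nat.ceil_lt_add_one (by linarith : 0 ≤ (2 * (Δ : ℝ)) ^ k * Real.log k)).le
  unfold iterationRounds collectionRounds
  push_cast
  rw [show 3 / 2 * (k * Real.log k) * (2 * (Δ : ℝ)) ^ k
    = 3 / 2 * k * ((2 * (Δ : ℝ)) ^ k * Real.log k) by ring]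
  generalize (2 * (Δ : ℝ)) ^ k * Real.log k = x at *
  nlinarith

/-- Tangent line of the logarithm at 4. The factor 2/3 cancels the 3/2 of `iterationRounds_le`, and
d - 1 is the denominator of the geometric sum. -/
lemma log_le_two_thirds_mul {d : ℝ} (hd : 4 ≤ d) : Real.log d ≤ 2 / 3 * (d - 1) := by
  have h1 := Real.log_le_sub_one_of_pos (by linarith : 0 < d / 4)
  rw [Real.log_div (by linarith) (by norm_num), show (4 : ℝ) = 2 ^ 2 by norm_num,
    Real.log_pow] at h1
  push_cast at h1
  linarith [Real.log_two_lt_d9]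

/-- The round at which the iteration with estimate `k` begins. -/
noncomputable def startRound (c : ℝ) (τ : ℕ → ℕ) (k : ℕ) : ℕ :=
  ∑ i ∈ Finset.Ico 2 k, iterationRounds c τ i

lemma startRound_succ (c : ℝ) (τ : ℕ → ℕ) {k : ℕ} (hk : 2 ≤ k) :
    startRound c τ (k + 1) = startRound c τ k + iterationRounds c τ k :=
  Finset.sum_Ico_succ_top hk _

lemma startRound_lt {c : ℝ} (hc : 1 < c) {Δ : ℕ} (hΔ : 2 ≤ Δ) {n : ℕ} (hn : 2 ≤ n) :
    (startRound c (collectionRounds Δ) (n + 1) : ℝ) <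
      (2 * (Δ : ℝ)) ^ (n + 1) * ((n : ℝ) + 1) * Real.log ((n : ℝ) + 1)
        / Real.log (2 * (Δ : ℝ)) := by
  have hn' : (2 : ℝ) ≤ n := by exact_mod_cast hn
  have hd : (4 : ℝ) ≤ 2 * Δ := by
    have : (2 : ℝ) ≤ Δ := by exact_mod_cast hΔ
    linarith
  have hlogn : 0 < Real.log n := Real.log_pos (by linarith)
  have hlogd : 0 < Real.log (2 * (Δ : ℝ)) := Real.log_pos (by linarith)
  have h1 : (startRound c (collectionRounds Δ) (n + 1) : ℝ) ≤
      3 / 2 * (n * Real.log n) * ∑ k ∈ Finset.Ico 2 (n + 1), (2 * (Δ : ℝ)) ^ k := by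
    unfold startRound
    push_cast
    rw [Finset.mul_sum]
    refine Finset.sum_le_sum fun k hk => ?_
    rw [Finset.mem_Ico] at hk
    have hk2 : (2 : ℝ) ≤ k := by exact_mod_cast hk.1
    have hkn : (k : ℝ) ≤ n := by exact_mod_cast (by omega : k ≤ n)
    have : 0 ≤ Real.log k := Real.log_nonneg (by linarith)
    refine (iterationRounds_le hc hΔ hk.1).trans ?_
    gcongr
  have h2 : ∑ k ∈ Finset.Ico 2 (n + 1), (2 * (Δ : ℝ)) ^ k
      ≤ (2 * (Δ : ℝ)) ^ (n + 1) / (2 * Δ - 1) := by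
    calc ∑ k ∈ Finset.Ico 2 (n + 1), (2 * (Δ : ℝ)) ^ k
        ≤ ∑ k ∈ Finset.range (n + 1), (2 * (Δ : ℝ)) ^ k := by
          refine Finset.sum_le_sum_of_subset_of_nonneg ?_ fun _ _ _ => by positivity
          rw [Finset.range_eq_Ico]
          exact Finset.Ico_subset_Ico_left (Nat.zero_le _)
      _ = ((2 * (Δ : ℝ)) ^ (n + 1) - 1) / (2 * Δ - 1) := geom_sum_eq (by linarith) _
      _ ≤ _ := by
          have : (0 : ℝ) < 2 * Δ - 1 := by linarith
          gcongr
          linarith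
  have h3 : (2 * (Δ : ℝ)) ^ (n + 1) / (2 * Δ - 1)
      ≤ 2 / 3 * ((2 * (Δ : ℝ)) ^ (n + 1) / Real.log (2 * Δ)) := by
    have := log_le_two_thirds_mul hd
    rw [← mul_div_assoc, div_le_div_iff₀ (by linarith) hlogd]
    have hp : (0 : ℝ) < (2 * (Δ : ℝ)) ^ (n + 1) := by positivity
    nlinarith
  have h4 : (n : ℝ) * Real.log n < (n + 1) * Real.log (n + 1) := by
    have : Real.log n ≤ Real.log (n + 1) := Real.log_le_log (by linarith) (by linarith)
    nlinarith
  calc (startRound c (collectionRounds Δ) (n + 1) : ℝ)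
      ≤ 3 / 2 * (n * Real.log n) * ∑ k ∈ Finset.Ico 2 (n + 1), (2 * (Δ : ℝ)) ^ k := h1
    _ ≤ 3 / 2 * (n * Real.log n) *
          (2 / 3 * ((2 * (Δ : ℝ)) ^ (n + 1) / Real.log (2 * Δ))) :=
        mul_le_mul_of_nonneg_left (h2.trans h3) (by positivity)
    _ = (n * Real.log n) * ((2 * (Δ : ℝ)) ^ (n + 1) / Real.log (2 * Δ)) := by ring
    _ < ((n + 1) * Real.log (n + 1)) * ((2 * (Δ : ℝ)) ^ (n + 1) / Real.log (2 * Δ)) :=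
        mul_lt_mul_of_pos_right h4 (by positivity)
    _ = _ := by ring

/-- This is the source of the condition n > 6, with m = n-1: the inequality fails at m = 5. -/
lemma mul_two_pow_le_four_pow {m : ℕ} (hm : 6 ≤ m) : 2 * m * (4 * 2 ^ m + 2) ≤ 4 ^ m := by
  have h : 8 * m + 1 ≤ 2 ^ m := by
    induction m, hm using Nat.le_induction with
    | base => norm_num
    | succ m _ ih => rw [pow_succ]; omega
  rw [show 4 = 2 ^ 2 by norm_num, ← pow_mul, mul_comm 2 m, pow_mul]
  nlinarith

/-- The exponent of decay in a Collection Phase. -/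
lemma le_collectionRounds_div {Δ n : ℕ} (hΔ : 2 ≤ Δ) (hn : 6 < n) {c : ℝ} (hc : c ≤ 2 ^ n) :
    (2 * c + 2) * Real.log n ≤
      collectionRounds Δ n * (1 / (4 * Δ * ((n : ℝ) - 1) ^ 2)) := by
  obtain ⟨m, rfl⟩ : ∃ m, n = m + 1 := ⟨n - 1, by omega⟩
  have hm : (6 : ℝ) ≤ m := by exact_mod_cast (by omega : 6 ≤ m)
  have hΔ' : (2 : ℝ) ≤ Δ := by exact_mod_cast hΔ
  have hlog : 0 ≤ Real.log ((m + 1 : ℕ) : ℝ) := Real.log_natCast_nonneg _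
  have h1 := mul_pow_mul_log_le_collectionRounds Δ (m + 1)
  have h2 : 2 * (m : ℝ) * (4 * 2 ^ m + 2) ≤ 4 ^ m := by
    exact_mod_cast mul_two_pow_le_four_pow (by omega : 6 ≤ m)
  have h3 : (4 : ℝ) ^ m ≤ (2 * (Δ : ℝ)) ^ m := by gcongr; linarith
  rw [pow_succ] at hc h1
  rw [mul_one_div, le_div_iff₀ (by push_cast; nlinarith [sq_nonneg ((m : ℝ))])]
  refine le_trans ?_ h1
  generalize Real.log ((m + 1 : ℕ) : ℝ) = lg at *
  push_cast
  -- From c ≤ 2^(m+1) comes 2c + 2 ≤ 4·2^m + 2, and 4 ≤ 2Δ. Cancelling 2Δ·ln n from the goal leaves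
  -- `h5`.
  have h4 : (2 * c + 2) * (2 * (m : ℝ)) ≤ (2 * (Δ : ℝ)) ^ m := by
    refine le_trans ?_ (h2.trans h3)
    nlinarith
  have h5 : (2 * c + 2) * (2 * (m : ℝ) ^ 2) ≤ (m + 1) * (2 * (Δ : ℝ)) ^ m := by
    have : (0 : ℝ) ≤ (2 * (Δ : ℝ)) ^ m := by positivity
    nlinarith
  have h6 := mul_le_mul_of_nonneg_right h5 (by positivity : 0 ≤ 2 * (Δ : ℝ) * lg)
  calc _ = (2 * c + 2) * (2 * (m : ℝ) ^ 2) * (2 * Δ * lg) := by ring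
    _ ≤ _ := h6
    _ = _ := by ring

end Bounds

/-! ### Wrong estimates are rejected, the right one is accepted -/

section Correctness

variable {V : Type*} [Fintype V] [DecidableEq V]

omit [DecidableEq V] in
-- A connected graph has at least n-1 edges, while Δ ≤ 1 would allow at most n/2.
lemma two_le_of_degree_le (H : SimpleGraph V) [DecidableRel H.Adj] (hH : H.Connected)
    (hcard : 2 < Fintype.card V) {Δ : ℕ} (hdeg : ∀ v, H.degree v ≤ Δ) : 2 ≤ Δ := by
  have h1 := hH.card_vert_le_card_edgeSet_add_one
  rw [Nat.card_eq_fintype_card, Nat.card_eq_fintype_card, ← SimpleGraph.edgeFinset_card] at h1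
  have h2 := H.sum_degrees_eq_twice_card_edges
  have h3 := Finset.sum_le_card_nsmul Finset.univ (fun v => H.degree v) Δ fun v _ => hdeg v
  rw [Finset.card_univ, smul_eq_mul] at h3
  by_contra! h
  have : Fintype.card V * Δ ≤ Fintype.card V * 1 := Nat.mul_le_mul_left _ (by omega)
  omega

variable (Δ : ℕ) (c : ℝ) (τ : ℕ → ℕ) (ℓ : V)
  (H : ℕ → SimpleGraph V) [∀ r, DecidableRel (H r).Adj] (k : ℕ)

lemma not_verified_of_lt_card (hΔ : 1 ≤ Δ) (hc : 1 < c) (hk : 2 ≤ k)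
    (hkn : k < Fintype.card V) (hconn : ∀ r, (H r).Connected)
    (hdeg : ∀ r v, (H r).degree v ≤ Δ) : ¬ Verified Δ c τ ℓ H k := by
  intro h
  have hq := card_low_energy_of_verified Δ c τ ℓ H k hconn h
  have he := leader_e_le_of_verified Δ c τ ℓ H k h
  have hcons := leader_e_add_sum_energyAt Δ c τ ℓ H k le_rfl
  have hx := fun v => (energyAt_mem_Icc Δ c τ ℓ H k hΔ hdeg le_rfl v).2
  have hxl := energyAt_leader Δ c τ ℓ H k (τ k)
  have ht0 := threshold_pos c hk
  have ht1 := mul_threshold_lt_one hc hk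
  have ht2 := threshold_lt_half hc hk
  rw [verificationRounds] at hq
  generalize energyAt Δ c τ ℓ H k (τ k) = x at *
  generalize threshold c k = t at *
  -- The leader counts as a low node but holds no energy here. Subtracting t for it yields q-1
  -- instead of q in `key`.
  have hle : ∀ v, x v ≤ (if x v ≤ t then t else 1) - (if v = ℓ then t else 0) := by
    intro v
    by_cases hv : v = ℓ
    · subst hv; simp [hxl, ht0.le]
    · rw [if_neg hv]; split_ifs with h1
      · simpa using h1
      · simpa using hx v
  have hsum := Finset.sum_le_sum fun v (_ : v ∈ Finset.univ) => hle v
  have hcompl := Finset.card_filter_add_card_filter_not (s := Finset.univ) (fun v => x v ≤ t)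
  rw [Finset.sum_sub_distrib, Finset.sum_ite, Finset.sum_const, Finset.sum_const,
    Finset.sum_ite_eq' , if_pos (Finset.mem_univ ℓ), nsmul_eq_mul, nsmul_eq_mul] at hsum
  rw [Finset.card_univ] at hcompl
  generalize (Finset.univ.filter fun v => x v ≤ t).card = q at *
  generalize (Finset.univ.filter fun v => ¬ x v ≤ t).card = q' at *
  have hcompl' : (q : ℝ) + q' = Fintype.card V := by exact_mod_cast hcompl
  have hkn' : (k : ℝ) + 1 ≤ Fintype.card V := by exact_mod_cast hkn
  -- The left side bounds the leader's energy from below: n - 1 - (q-1)t - q' with n = q + q'.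
  have key : ((q : ℝ) - 1) * (1 - t) ≤ k - 1 := by nlinarith
  have hk' : (2 : ℝ) ≤ k := by exact_mod_cast hk
  -- If q = n, then (q-1)(1-t) ≥ k(1-t) > k-1 because kt < 1. Otherwise q-1 ≥ k/(1-t), which gives
  -- at least k.
  rcases min_le_iff.1 hq with hq | hq
  · have hq' : (Fintype.card V : ℝ) ≤ q := by exact_mod_cast hq
    nlinarith
  · have hq' : (⌈(k : ℝ) / (1 - t)⌉₊ : ℝ) + 2 ≤ q := by exact_mod_cast (by omega)
    have h1 := Nat.le_ceil ((k : ℝ) / (1 - t))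
    have h2 : (k : ℝ) / (1 - t) ≤ q - 1 := by linarith
    rw [div_le_iff₀ (by linarith)] at h2
    linarith

lemma verified_of_card_eq (hΔ : 2 ≤ Δ) (hk : 6 < k) (hc : c ≤ 2 ^ k)
    (hcard : Fintype.card V = k) (hconn : ∀ r, (H r).Connected)
    (hdeg : ∀ r v, (H r).degree v ≤ Δ) :
    Verified Δ c (collectionRounds Δ) ℓ H k := by
  have hk' : (0 : ℝ) < k := by exact_mod_cast (by omega : 0 < k)
  refine verified_of_sum_le Δ c _ ℓ H k (by omega) hdeg hcard ?_
  have h1 := sum_sq_energyAt_le Δ c (collectionRounds Δ) ℓ H k (by omega) hconn hdeg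
    (by omega) le_rfl
  have h2 := sq_sum_le_card_mul_sum_sq (s := Finset.univ)
    (f := energyAt Δ c (collectionRounds Δ) ℓ H k (collectionRounds Δ k))
  have h3 := le_collectionRounds_div hΔ hk hc
  rw [Finset.card_univ] at h2
  rw [hcard] at h1 h2
  have hδ : 1 / (4 * (Δ : ℝ) * ((k : ℝ) - 1) ^ 2) ≤ 1 := by
    have hΔ' : (2 : ℝ) ≤ Δ := by exact_mod_cast hΔ
    have hk6 : (6 : ℝ) < k := by exact_mod_cast hk
    have : 1 ≤ ((k : ℝ) - 1) ^ 2 := by nlinarith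
    rw [div_le_one (by positivity)]
    nlinarith
  generalize 1 / (4 * (Δ : ℝ) * ((k : ℝ) - 1) ^ 2) = δ at *
  have hdecay : (1 - δ) ^ collectionRounds Δ k ≤ Real.exp (-((2 * c + 2) * Real.log k)) := by
    calc (1 - δ) ^ collectionRounds Δ k ≤ Real.exp (-δ) ^ collectionRounds Δ k :=
          pow_le_pow_left₀ (by linarith) (Real.one_sub_le_exp_neg δ) _
      _ = Real.exp (-(collectionRounds Δ k * δ)) := by rw [← Real.exp_nat_mul]; ring_nf
      _ ≤ _ := Real.exp_le_exp.2 (by linarith)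
  -- Origin of the exponent 2c + 2: the squared threshold needs 2c. The other 2 pays for two factors
  -- k, one from Cauchy–Schwarz and one from the initial sum of squares.
  have hexp : (k : ℝ) * (Real.exp (-((2 * c + 2) * Real.log k)) * k) = threshold c k ^ 2 := by
    rw [threshold, Real.rpow_def_of_pos hk', one_div, ← Real.exp_neg, ← Real.exp_nat_mul]
    nth_rewrite 1 [← Real.exp_log hk']
    nth_rewrite 3 [← Real.exp_log hk']
    rw [← Real.exp_add, ← Real.exp_add]
    push_cast
    ring_nf
  refine (abs_le_of_sq_le_sq' ?_ (threshold_pos c (by omega)).le).2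
  rw [← hexp]
  refine h2.trans (mul_le_mul_of_nonneg_left (h1.trans ?_) hk'.le)
  exact mul_le_mul_of_nonneg_right hdecay hk'.le

variable (G : ℕ → SimpleGraph V) [∀ r, DecidableRel (G r).Adj]

lemma run_startRound (hΔ : 1 ≤ Δ) (hc : 1 < c) (hconn : ∀ r, (G r).Connected)
    (hdeg : ∀ r v, (G r).degree v ≤ Δ) (hk : 2 ≤ k) (hkn : k ≤ Fintype.card V) :
    (countingProtocol Δ c τ).run ℓ G (startRound c τ k) = (Vars.start V k).state ℓ := by
  induction k, hk using Nat.le_induction with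
  | base =>
    rw [startRound, Finset.Ico_self, Finset.sum_empty]
    rfl
  | succ k hk ih =>
    rw [startRound_succ c τ hk]
    exact run_eq_start_of_not_verified Δ c τ ℓ G k _ (ih (by omega))
      (not_verified_of_lt_card Δ c τ ℓ _ k hΔ hc hk hkn (fun r => hconn _) fun r => hdeg _)

lemma output_eq_none_of_lt_startRound (hΔ : 1 ≤ Δ) (hc : 1 < c) (hconn : ∀ r, (G r).Connected)
    (hdeg : ∀ r v, (G r).degree v ≤ Δ) (hk : 2 ≤ k) (hkn : k ≤ Fintype.card V + 1) {t : ℕ}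
    (ht : t < startRound c τ k) (v : V) :
    (countingProtocol Δ c τ).output ((countingProtocol Δ c τ).run ℓ G t v) = none := by
  induction k, hk using Nat.le_induction with
  | base => simp [startRound] at ht
  | succ k hk ih =>
    rw [startRound_succ c τ hk] at ht
    rcases lt_or_ge t (startRound c τ k) with h | h
    · exact ih (by omega) h
    · obtain ⟨j, rfl⟩ := Nat.exists_eq_add_of_le h
      rw [run_add_eq_state Δ c τ ℓ G k _
        (run_startRound Δ c τ ℓ k G hΔ hc hconn hdeg hk (by omega)) (by omega)]
      exact output_state Δ c τ ℓ _ v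

end Correctness

end AnonymousCounting

theorem corollary1 {V : Type*} [Fintype V] [DecidableEq V] (n Δ : ℕ) (c : ℝ)
    (hn : 6 < n) (hcard : Fintype.card V = n)
    (hΔ1 : 1 ≤ Δ) (hΔn : Δ ≤ n - 1)
    (hc1 : 1 < c) (hc2 : c ≤ 2 ^ n)
    (ℓ : V) (G : ℕ → SimpleGraph V) [∀ r, DecidableRel (G r).Adj]
    (hconn : ∀ r, (G r).Connected)
    (hdeg : ∀ r v, (G r).degree v ≤ Δ) :
    ∃ r : ℕ,
      (r : ℝ) < (2 * (Δ : ℝ)) ^ (n + 1) * ((n : ℝ) + 1) * Real.log ((n : ℝ) + 1)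
          / Real.log (2 * (Δ : ℝ)) ∧
      (∀ t, r ≤ t → ∀ v, (AnonymousCounting.countingProtocol Δ c
          (AnonymousCounting.collectionRounds Δ)).output
            ((AnonymousCounting.countingProtocol Δ c
              (AnonymousCounting.collectionRounds Δ)).run ℓ G t v) = some n) ∧
      (∀ t, t < r → ∀ v, (AnonymousCounting.countingProtocol Δ c
          (AnonymousCounting.collectionRounds Δ)).output
            ((AnonymousCounting.countingProtocol Δ c
              (AnonymousCounting.collectionRounds Δ)).run ℓ G t v) = none) := by
  subst hcard
  have hΔ2 : 2 ≤ Δ :=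
    AnonymousCounting.two_le_of_degree_le (G 0) (hconn 0) (by omega) (hdeg 0)
  refine ⟨AnonymousCounting.startRound c (AnonymousCounting.collectionRounds Δ)
    (Fintype.card V + 1), AnonymousCounting.startRound_lt hc1 hΔ2 (by omega), ?_, ?_⟩
  · intro t ht v
    have hfinal := AnonymousCounting.run_eq_stopped_of_verified Δ c
      (AnonymousCounting.collectionRounds Δ) ℓ G (Fintype.card V) _ hconn rfl
      (AnonymousCounting.run_startRound Δ c _ ℓ _ G hΔ1 hc1 hconn hdeg (by omega) le_rfl)
      (AnonymousCounting.verified_of_card_eq Δ c ℓ _ _ hΔ2 hn hc2 rfl (fun r => hconn _)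
        fun r => hdeg _) v
    rw [← AnonymousCounting.startRound_succ c _ (by omega)] at hfinal
    rw [AnonymousCounting.run_eq_stopped_of_le Δ c _ ℓ G _ _ hfinal ht]
  · intro t ht v
    exact AnonymousCounting.output_eq_none_of_lt_startRound Δ c _ ℓ _ G hΔ1 hc1 hconn hdeg
      (by omega) le_rfl ht v
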